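/- Theorem (Convergence of the $\Omega$ fixed point algorithm). Call a complex $d\times d$ matrix a state if it is positive semidefinite with trace $1$, and a full-rank state if moreover it is positive definite. For a positive semidefinite matrix $P$, let $P^{1/2}=\sqrt{P}$ denote its unique positive semidefinite square root. Let $\rho_1,\dots,\rho_n$ be full-rank $d\times d$ states and let $p=(p_1,\dots,p_n)$ be a probability vector ($p_i\ge 0$, $\sum_i p_i=1$). For a state $\sigma$ let $$f(\sigma)=\sum_{i=1}^n p_i\,\mathrm F(\rho_i,\sigma),\qquad \mathrm F(\rho,\sigma)=\operatorname{Tr}\sqrt{\sigma^{1/2}\rho\,\sigma^{1/2}},$$ be the average fidelity, and for positive definite $\sigma$ let $$\Omega(\sigma)=\Gamma\Bigl(\sigma^{-1/2}\Bigl(\sum_{i=1}^n p_i\sqrt{\sigma^{1/2}\rho_i\,\sigma^{1/2}}\Bigr)^{2}\sigma^{-1/2}\Bigr),\qquad \Gamma(A)=A/\operatorname{Tr}(A).$$ Then $\Omega$ is well defined and maps positive definite matrices to full-rank states; there is exactly one optimal state $\sigma_\sharp$, i.e. exactly one maximizer of $f$ over the set of all $d\times d$ states; and for every full-rank initial state $\sigma$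 the iterates $\Omega^k(\sigma)$, defined by $\Omega^0(\sigma)=\sigma$ and $\Omega^k(\sigma)=\Omega(\Omega^{k-1}(\sigma))$, converge to $\sigma_\sharp$ as $k\to\infty$. -/

import Mathlib

open scoped MatrixOrder ComplexOrder

namespace AvgFidelity

variable {d n : ℕ}

/-- Density matrices on `ℂ^d`: positive semidefinite with unit trace. -/
def IsDensity (σ : Matrix (Fin d) (Fin d) ℂ) : Prop :=
  σ.PosSemidef ∧ σ.trace = 1

/-- Full-rank states: positive definite density matrices. -/
def IsFullRankState (σ : Matrix (Fin d) (Fin d) ℂ) : Prop :=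
  σ.PosDef ∧ IsDensity σ

/-- The (square-root) fidelity `F(ρ, σ) = Tr √(σ^{1/2} ρ σ^{1/2})`. The matrix square root is
the positive semidefinite one, `CFC.sqrt`; the trace is real for positive semidefinite
`ρ`, `σ`. -/
noncomputable def fidelity (ρ σ : Matrix (Fin d) (Fin d) ℂ) : ℝ :=
  (CFC.sqrt (CFC.sqrt σ * ρ * CFC.sqrt σ)).trace.re

/-- The average fidelity `f(σ) = ∑ i, p i * F(ρ i, σ)`. -/
noncomputable def avgFidelity (p : Fin n → ℝ) (ρ : Fin n → Matrix (Fin d) (Fin d) ℂ)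
    (σ : Matrix (Fin d) (Fin d) ℂ) : ℝ :=
  ∑ i, p i * fidelity (ρ i) σ

/-- `σ` is an optimal state: it maximizes the average fidelity over all density matrices
(including those that are not of full rank). -/
def IsOptimalState (p : Fin n → ℝ) (ρ : Fin n → Matrix (Fin d) (Fin d) ℂ)
    (σ : Matrix (Fin d) (Fin d) ℂ) : Prop :=
  IsDensity σ ∧ ∀ τ : Matrix (Fin d) (Fin d) ℂ, IsDensity τ →
    avgFidelity p ρ τ ≤ avgFidelity p ρ σ

/-- Normalization `Γ(A) = A / Tr A`. -/
noncomputable def normalize (A : Matrix (Fin d) (Fin d) ℂ) : Matrix (Fin d) (Fin d) ℂ :=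
  A.trace⁻¹ • A

/-- `K(σ) = σ^{-1/2} (∑ i, p i √(σ^{1/2} ρ i σ^{1/2}))² σ^{-1/2}`, for positive definite `σ`. -/
noncomputable def kMap (p : Fin n → ℝ) (ρ : Fin n → Matrix (Fin d) (Fin d) ℂ)
    (σ : Matrix (Fin d) (Fin d) ℂ) : Matrix (Fin d) (Fin d) ℂ :=
  (CFC.sqrt σ)⁻¹ * (∑ i, p i • CFC.sqrt (CFC.sqrt σ * ρ i * CFC.sqrt σ)) ^ 2 * (CFC.sqrt σ)⁻¹

/-- `Ω(σ) = Γ(K(σ))`, for positive definite `σ`. -/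
noncomputable def omegaMap (p : Fin n → ℝ) (ρ : Fin n → Matrix (Fin d) (Fin d) ℂ)
    (σ : Matrix (Fin d) (Fin d) ℂ) : Matrix (Fin d) (Fin d) ℂ :=
  normalize (kMap p ρ σ)

end AvgFidelity

namespace AvgFidelity

variable {d n : ℕ}

open Matrix

/-! For positive definite `X`, completing a square gives `2 F(ρ,τ) ≤ Tr X⁻¹ρ + Tr Xτ`, with equality
only if `XτX = ρ` (`two_mul_fidelity_le_and_eq`). Let `X i` solve `X i * σ * X i = ρ i` and let `T =
∑ p i • X i`. Then `f(σ) = Tr Tσ` and `K(σ) = TσT`.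

Ascent: `f(σ) ≤ √Tr K(σ) ≤ f(Ω(σ))`. The first inequality says that the variance of `T` in the state
`σ` is nonnegative; the second is a purification estimate (`sqrt_trace_kMap_le`). If `f` does not
increase, the variance vanishes and `T` is scalar. Summing the variational bound with these `X i`
then shows that `σ` is the unique maximizer (`avgFidelity_le_and_eq_of_meanTransport_eq`).

Convergence: `f` increases along an orbit and is bounded, so by continuity it is constant under `Ω`
at each cluster point, provided that point is positive definite. This follows from a lower bound for
`det Ω(σ)` uniform in `σ` (`exists_le_det_omegaMap`). All cluster points are therefore the
maximizer, and compactness gives convergence. -/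

/-! ### Square roots, determinants and compactness of the state space. -/

lemma continuousOn_matrix_sqrt :
    ContinuousOn (CFC.sqrt : Matrix (Fin d) (Fin d) ℂ → Matrix (Fin d) (Fin d) ℂ)
      {A | A.PosSemidef} := by
  open scoped Matrix.Norms.L2Operator in
  simpa only [Matrix.nonneg_iff_posSemidef] using
    CFC.continuousOn_sqrt (A := Matrix (Fin d) (Fin d) ℂ)

lemma sqrt_posSemidef (A : Matrix (Fin d) (Fin d) ℂ) : (CFC.sqrt A).PosSemidef :=
  Matrix.nonneg_iff_posSemidef.1 (CFC.sqrt_nonneg A)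

lemma sqrt_mul_sqrt {A : Matrix (Fin d) (Fin d) ℂ} (hA : A.PosSemidef) :
    CFC.sqrt A * CFC.sqrt A = A :=
  CFC.sqrt_mul_sqrt_self A (Matrix.nonneg_iff_posSemidef.2 hA)

lemma sqrt_eq_of_mul_self {A B : Matrix (Fin d) (Fin d) ℂ} (hB : B.PosSemidef)
    (h : B * B = A) : CFC.sqrt A = B :=
  CFC.sqrt_unique h (Matrix.nonneg_iff_posSemidef.2 hB)

lemma sqrt_posDef {A : Matrix (Fin d) (Fin d) ℂ} (hA : A.PosDef) : (CFC.sqrt A).PosDef :=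
  (Matrix.isStrictlyPositive_iff_posDef).1
    (IsStrictlyPositive.sqrt A (Matrix.isStrictlyPositive_iff_posDef.2 hA))

lemma sqrt_mono {A B : Matrix (Fin d) (Fin d) ℂ} (h : A ≤ B) : CFC.sqrt A ≤ CFC.sqrt B := by
  open scoped Matrix.Norms.L2Operator in
  exact CFC.sqrt_le_sqrt A B h

lemma one_le_det_one_add {N : Matrix (Fin d) (Fin d) ℂ} (hN : N.PosSemidef) :
    1 ≤ (1 + N).det.re := by
  classical
  have h : 1 + N = (hN.1.eigenvectorUnitary : Matrix (Fin d) (Fin d) ℂ) *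
      (1 + diagonal (RCLike.ofReal ∘ hN.1.eigenvalues)) *
      (star hN.1.eigenvectorUnitary : Matrix (Fin d) (Fin d) ℂ) := by
    conv_lhs => rw [hN.1.spectral_theorem]
    simp [Unitary.conjStarAlgAut_apply, mul_add, add_mul]
  have h2 : (1 + N).det = ∏ i, ((1 + hN.1.eigenvalues i : ℝ) : ℂ) := by
    rw [h, det_mul_right_comm, Unitary.mul_star_self_of_mem hN.1.eigenvectorUnitary.2, one_mul, ← diagonal_one, diagonal_add,
      det_diagonal]
    simp
  rw [h2, ← Complex.ofReal_prod, Complex.ofReal_re]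
  refine Finset.one_le_prod fun i _ => ?_
  have := hN.eigenvalues_nonneg i
  simp; linarith

/-- Conjugation by `B^{-1/2}` reduces this to `1 ≤ det (1 + N)` with `N` positive semidefinite. -/
lemma det_le_det {A B : Matrix (Fin d) (Fin d) ℂ} (hB : B.PosDef) (h : B ≤ A) :
    B.det.re ≤ A.det.re := by
  have hs := sqrt_posDef hB
  set s := CFC.sqrt B with hsdef
  have hss : s * s = B := sqrt_mul_sqrt hB.posSemidef
  have hu : IsUnit s.det := (Matrix.isUnit_iff_isUnit_det _).1 hs.isUnit
  have hN : (s⁻¹ * (A - B) * s⁻¹).PosSemidef := by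
    have := (Matrix.le_iff.1 h).conjTranspose_mul_mul_same s⁻¹
    rwa [hs.inv.isHermitian.eq] at this
  have hA : A = s * (1 + s⁻¹ * (A - B) * s⁻¹) * s := by
    rw [mul_add, add_mul, mul_one, hss]
    simp only [← mul_assoc, mul_nonsing_inv _ hu, one_mul]
    rw [mul_assoc, nonsing_inv_mul _ hu, mul_one]; abel
  have hd : A.det = B.det * (1 + s⁻¹ * (A - B) * s⁻¹).det := by
    conv_lhs => rw [hA]
    rw [← hss]; simp only [det_mul]; ring
  have hb := hB.det_pos
  rw [Complex.lt_def] at hb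
  rw [hd, Complex.mul_re, ← hb.2]
  have := one_le_det_one_add hN
  simp only [Complex.zero_re, Complex.zero_im, zero_mul, sub_zero] at hb ⊢
  nlinarith [hb.1]

/-- The set of density matrices is the image of a sphere under `s ↦ sᴴ * s`. -/
lemma isCompact_density : IsCompact {σ : Matrix (Fin d) (Fin d) ℂ | IsDensity σ} := by
  have h1 : {σ : Matrix (Fin d) (Fin d) ℂ | IsDensity σ} =
      (fun s : Matrix (Fin d) (Fin d) ℂ => sᴴ * s) '' {s | (sᴴ * s).trace = 1} := by
    ext σ
    constructor
    · rintro ⟨h, ht⟩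
      refine ⟨CFC.sqrt σ, ?_, ?_⟩ <;>
      simp [(sqrt_posSemidef σ).1.eq, sqrt_mul_sqrt h, ht]
    · rintro ⟨s, hs, rfl⟩
      exact ⟨posSemidef_conjTranspose_mul_self s, hs⟩
  rw [h1]
  refine IsCompact.image ?_ (by fun_prop)
  have hc : IsCompact (Set.univ.pi fun _ : Fin d => Set.univ.pi fun _ : Fin d =>
      Metric.closedBall (0 : ℂ) 1) :=
    isCompact_univ_pi fun _ => isCompact_univ_pi fun _ => isCompact_closedBall _ _
  refine hc.of_isClosed_subset ?_ ?_
  · exact isClosed_eq (f := fun s : Matrix (Fin d) (Fin d) ℂ => (sᴴ * s).trace)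
      (by fun_prop) continuous_const
  · intro (s : Matrix (Fin d) (Fin d) ℂ) (hs : (sᴴ * s).trace = 1) i _ j _
    have hs' : ∑ j, ∑ i, ‖s i j‖ ^ 2 = 1 := by
      have h := congrArg Complex.re hs
      simp only [trace, diag_apply, mul_apply, conjTranspose_apply, Complex.re_sum] at h
      simpa [Complex.sq_norm, Complex.normSq_apply] using h
    have h2 : ‖s i j‖ ^ 2 ≤ 1 := by
      rw [← hs']
      refine le_trans ?_ (Finset.single_le_sum (fun j _ => Finset.sum_nonneg fun i _ =>
        sq_nonneg ‖s i j‖) (Finset.mem_univ j))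
      exact Finset.single_le_sum (f := fun i => ‖s i j‖ ^ 2) (fun i _ => sq_nonneg _)
        (Finset.mem_univ i)
    simpa using (sq_le_one_iff₀ (norm_nonneg _)).1 h2

/-! ### The variational bound on the fidelity. -/

lemma trace_conj_nonneg {Y : Matrix (Fin d) (Fin d) ℂ} (hY : Y.PosDef)
    (G : Matrix (Fin d) (Fin d) ℂ) : 0 ≤ (Gᴴ * Y * G).trace.re :=
  (Complex.le_def.1 (hY.posSemidef.conjTranspose_mul_mul_same G).trace_nonneg).1

lemma eq_zero_of_trace_conj_eq_zero {Y : Matrix (Fin d) (Fin d) ℂ} (hY : Y.PosDef)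
    {G : Matrix (Fin d) (Fin d) ℂ} (h : (Gᴴ * Y * G).trace.re = 0) : G = 0 := by
  have hs := sqrt_posDef hY
  have hu : IsUnit (CFC.sqrt Y).det := (Matrix.isUnit_iff_isUnit_det _).1 hs.isUnit
  have h1 : (Gᴴ * Y * G).trace = 0 := by
    have := Complex.le_def.1 (hY.posSemidef.conjTranspose_mul_mul_same G).trace_nonneg
    exact Complex.ext h this.2.symm
  have h2 : (CFC.sqrt Y * G)ᴴ * (CFC.sqrt Y * G) = Gᴴ * Y * G := by
    rw [conjTranspose_mul, hs.1.eq]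
    conv_rhs => rw [← sqrt_mul_sqrt hY.posSemidef]
    simp only [mul_assoc]
  rw [← h2, trace_conjTranspose_mul_self_eq_zero_iff] at h1
  rw [← one_mul G, ← nonsing_inv_mul _ hu, mul_assoc, h1, mul_zero]

/-- The completed square behind the variational bound and its equality case. -/
lemma trace_sub_conj {X : Matrix (Fin d) (Fin d) ℂ} (hX : X.PosDef)
    (A B : Matrix (Fin d) (Fin d) ℂ) :
    ((A - X * B)ᴴ * X⁻¹ * (A - X * B)).trace.re =
      (X⁻¹ * (A * Aᴴ)).trace.re + (X * (B * Bᴴ)).trace.re - 2 * (Aᴴ * B).trace.re := by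
  have hu : IsUnit X.det := (Matrix.isUnit_iff_isUnit_det _).1 hX.isUnit
  have h : (A - X * B)ᴴ * X⁻¹ * (A - X * B) =
      Aᴴ * X⁻¹ * A - Aᴴ * B - (Aᴴ * B)ᴴ + Bᴴ * X * B := by
    rw [conjTranspose_sub, conjTranspose_mul, conjTranspose_mul, conjTranspose_conjTranspose,
      hX.1.eq]
    have e1 : Aᴴ * X⁻¹ * (X * B) = Aᴴ * B := by
      rw [mul_assoc, ← mul_assoc X⁻¹, nonsing_inv_mul _ hu, one_mul]
    have e2 : Bᴴ * X * X⁻¹ = Bᴴ := by rw [mul_assoc, mul_nonsing_inv _ hu, mul_one]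
    rw [sub_mul, sub_mul, mul_sub, mul_sub, e1, e2, ← mul_assoc]
    abel
  rw [h, trace_add, trace_sub, trace_sub, trace_conjTranspose, trace_mul_cycle Aᴴ,
    trace_mul_comm (A * Aᴴ), trace_mul_cycle Bᴴ, trace_mul_comm (B * Bᴴ)]
  simp
  ring

lemma two_mul_trace_le {X : Matrix (Fin d) (Fin d) ℂ} (hX : X.PosDef)
    (A B : Matrix (Fin d) (Fin d) ℂ) :
    2 * (Aᴴ * B).trace.re ≤ (X⁻¹ * (A * Aᴴ)).trace.re + (X * (B * Bᴴ)).trace.re := by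
  have h1 := trace_conj_nonneg hX.inv (A - X * B)
  rw [trace_sub_conj hX] at h1
  linarith

lemma eq_mul_of_two_mul_trace_eq {X : Matrix (Fin d) (Fin d) ℂ} (hX : X.PosDef)
    {A B : Matrix (Fin d) (Fin d) ℂ}
    (h : 2 * (Aᴴ * B).trace.re = (X⁻¹ * (A * Aᴴ)).trace.re + (X * (B * Bᴴ)).trace.re) :
    A = X * B := by
  refine sub_eq_zero.1 (eq_zero_of_trace_conj_eq_zero hX.inv ?_)
  rw [trace_sub_conj hX]
  linarith

/-- A polar decomposition, with a partial isometry. -/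
lemma exists_mul_eq_sqrt (C : Matrix (Fin d) (Fin d) ℂ) :
    ∃ W : Matrix (Fin d) (Fin d) ℂ, W * C = CFC.sqrt (Cᴴ * C) ∧ (1 - Wᴴ * W).PosSemidef := by
  have hR := sqrt_posSemidef (Cᴴ * C)
  have hRR := sqrt_mul_sqrt (posSemidef_conjTranspose_mul_self C)
  set R := CFC.sqrt (Cᴴ * C)
  have hsa : IsSelfAdjoint R := hR.1
  have hcont : ∀ f : ℝ → ℝ, ContinuousOn f (spectrum ℝ R) := fun f =>
    (Matrix.finite_real_spectrum (A := R)).continuousOn f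
  -- `g` is the pseudo-inverse of `R`: the convention `0⁻¹ = 0` inverts only the nonzero
  -- eigenvalues, so `C` may be singular.
  obtain ⟨g, hg, hgRR, hgRg⟩ : ∃ g : Matrix (Fin d) (Fin d) ℂ,
      gᴴ = g ∧ g * R * R = R ∧ g * R * R * g * g = g := by
    have hm : ∀ f : ℝ → ℝ, cfc f R * R = cfc (fun x => f x * x) R := fun f => by
      conv_lhs => rhs; rw [← cfc_id' ℝ R]
      exact (cfc_mul f (fun x => x) R (hcont _) (hcont _)).symm
    have hm' : ∀ f g : ℝ → ℝ, cfc f R * cfc g R = cfc (fun x => f x * g x) R := fun f g =>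
      (cfc_mul f g R (hcont _) (hcont _)).symm
    refine ⟨cfc (fun x : ℝ => x⁻¹) R, ?_, ?_, ?_⟩
    · exact (cfc_predicate (fun x : ℝ => x⁻¹) R : IsSelfAdjoint _)
    · rw [hm, hm]
      conv_rhs => rw [← cfc_id' ℝ R]
      congr 1; ext x
      by_cases hx : x = 0 <;> simp [hx]
    · rw [hm, hm, hm', hm']
      congr 1; ext x
      by_cases hx : x = 0 <;> simp [hx]
  refine ⟨g * Cᴴ, by rw [mul_assoc, ← hRR, ← mul_assoc, hgRR], ?_⟩
  have hW : (g * Cᴴ)ᴴ * (g * Cᴴ) = C * g * g * Cᴴ := by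
    rw [conjTranspose_mul, conjTranspose_conjTranspose, hg]; simp only [mul_assoc]
  set Q := (g * Cᴴ)ᴴ * (g * Cᴴ) with hQ
  have hQh : Qᴴ = Q := (posSemidef_conjTranspose_mul_self (g * Cᴴ)).1
  have hQQ : Q * Q = Q := by
    rw [hW]
    have : C * g * g * Cᴴ * (C * g * g * Cᴴ) = C * g * (g * (Cᴴ * C) * g * g) * Cᴴ := by
      simp only [mul_assoc]
    rw [this, ← hRR, ← mul_assoc g R R, hgRg]
  -- `Q` is an orthogonal projection, hence so is `1 - Q`.
  have : 1 - Q = (1 - Q)ᴴ * (1 - Q) := by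
    rw [conjTranspose_sub, conjTranspose_one, hQh, sub_mul, one_mul, mul_sub, mul_one, hQQ]
    abel
  rw [this]
  exact posSemidef_conjTranspose_mul_self _

/-- The square is completed with `A = r * Wᴴ` and `B = b`, for which `Tr AᴴB` is the fidelity. As
`W` is only a contraction, `ρ` exceeds `A * Aᴴ` by the positive term built from `z`; equality kills
this term and forces `A = X * b`. Singular `τ` must be allowed because competitors for the maximum
need not have full rank. -/
lemma two_mul_fidelity_le_and_eq {X ρ τ : Matrix (Fin d) (Fin d) ℂ} (hX : X.PosDef)
    (hρ : ρ.PosSemidef) (hτ : τ.PosSemidef) :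
    2 * fidelity ρ τ ≤ (X⁻¹ * ρ).trace.re + (X * τ).trace.re ∧
    (2 * fidelity ρ τ = (X⁻¹ * ρ).trace.re + (X * τ).trace.re → X * τ * X = ρ) := by
  have hrr := sqrt_mul_sqrt hρ
  have hbb := sqrt_mul_sqrt hτ
  have hr := (sqrt_posSemidef ρ).1.eq
  have hb := (sqrt_posSemidef τ).1.eq
  unfold fidelity
  set r := CFC.sqrt ρ
  set b := CFC.sqrt τ
  obtain ⟨W, hW, hWW⟩ := exists_mul_eq_sqrt (r * b)
  have hN : (r * b)ᴴ * (r * b) = b * ρ * b := by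
    rw [conjTranspose_mul, hr, hb, ← hrr]; simp only [mul_assoc]
  rw [hN] at hW
  have hz := (sqrt_posSemidef (1 - Wᴴ * W)).1.eq
  have hzz := sqrt_mul_sqrt hWW
  set z := CFC.sqrt (1 - Wᴴ * W)
  have hA : (r * Wᴴ)ᴴ * b = CFC.sqrt (b * ρ * b) := by
    rw [← hW, conjTranspose_mul, conjTranspose_conjTranspose, hr, mul_assoc]
  have hB : b * bᴴ = τ := by rw [hb, hbb]
  have hS : ρ = r * Wᴴ * (r * Wᴴ)ᴴ + (r * z) * (r * z)ᴴ := by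
    have : r * z * (r * z)ᴴ = r * (z * z) * r := by
      rw [conjTranspose_mul, hr, hz]; simp only [mul_assoc]
    rw [this, hzz, conjTranspose_mul, conjTranspose_conjTranspose, hr, mul_sub, sub_mul, mul_one,
      hrr]
    simp only [mul_assoc]; abel
  have ht : (X⁻¹ * ρ).trace.re =
      (X⁻¹ * (r * Wᴴ * (r * Wᴴ)ᴴ)).trace.re + ((r * z)ᴴ * X⁻¹ * (r * z)).trace.re := by
    conv_lhs => rw [hS]
    rw [mul_add, trace_add, Complex.add_re, trace_mul_cycle, trace_mul_comm (r * z * (r * z)ᴴ)]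
  have h1 := two_mul_trace_le hX (r * Wᴴ) b
  have h2 := trace_conj_nonneg hX.inv (r * z)
  rw [hA, hB] at h1
  refine ⟨by linarith, fun h => ?_⟩
  have h3 : r * z = 0 := eq_zero_of_trace_conj_eq_zero hX.inv (by linarith)
  have h4 : r * Wᴴ = X * b := eq_mul_of_two_mul_trace_eq hX (by rw [hA, hB]; linarith)
  rw [h3, h4] at hS
  rw [hS, conjTranspose_mul, hb, hX.1.eq, ← hbb]
  simp only [mul_assoc, zero_mul, add_zero]

/-! ### Transport between states. -/

/-- The matrix geometric mean of `ρ` and `σ⁻¹`: the positive definite solution of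
`X * σ * X = ρ`. -/
noncomputable def transport (ρ σ : Matrix (Fin d) (Fin d) ℂ) : Matrix (Fin d) (Fin d) ℂ :=
  (CFC.sqrt σ)⁻¹ * CFC.sqrt (CFC.sqrt σ * ρ * CFC.sqrt σ) * (CFC.sqrt σ)⁻¹

section transport

variable {ρ σ : Matrix (Fin d) (Fin d) ℂ}

lemma sqrt_conj_posDef (hρ : ρ.PosDef) (hσ : σ.PosDef) :
    (CFC.sqrt σ * ρ * CFC.sqrt σ).PosDef := by
  have hs := sqrt_posDef hσ
  have := (hs.isUnit.posDef_star_right_conjugate_iff (x := ρ)).2 hρ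
  rwa [star_eq_conjTranspose, hs.1.eq] at this

lemma conj_inv_posDef {A S : Matrix (Fin d) (Fin d) ℂ} (hA : A.PosDef) (hS : S.PosDef) :
    (S⁻¹ * A * S⁻¹).PosDef := by
  have := (hS.inv.isUnit.posDef_star_right_conjugate_iff (x := A)).2 hA
  rwa [star_eq_conjTranspose, hS.inv.1.eq] at this

lemma transport_posDef (hρ : ρ.PosDef) (hσ : σ.PosDef) : (transport ρ σ).PosDef :=
  conj_inv_posDef (sqrt_posDef (sqrt_conj_posDef hρ hσ)) (sqrt_posDef hσ)

lemma isUnit_det_sqrt (hσ : σ.PosDef) : IsUnit (CFC.sqrt σ).det :=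
  (Matrix.isUnit_iff_isUnit_det _).1 (sqrt_posDef hσ).isUnit

lemma conj_inv_mul_mul_conj_inv {s : Matrix (Fin d) (Fin d) ℂ} (hs : IsUnit s.det)
    (A B : Matrix (Fin d) (Fin d) ℂ) :
    s⁻¹ * A * s⁻¹ * (s * s) * (s⁻¹ * B * s⁻¹) = s⁻¹ * (A * B) * s⁻¹ := by
  have e : s⁻¹ * (s * s) * s⁻¹ = 1 := by
    rw [← mul_assoc, nonsing_inv_mul _ hs, one_mul, mul_nonsing_inv _ hs]
  calc _ = s⁻¹ * A * (s⁻¹ * (s * s) * s⁻¹) * B * s⁻¹ := by simp only [mul_assoc]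
    _ = _ := by rw [e, mul_one]; simp only [mul_assoc]

lemma transport_mul_mul_transport (hρ : ρ.PosDef) (hσ : σ.PosDef) :
    transport ρ σ * σ * transport ρ σ = ρ := by
  have hu := isUnit_det_sqrt hσ
  have h := conj_inv_mul_mul_conj_inv hu (CFC.sqrt (CFC.sqrt σ * ρ * CFC.sqrt σ))
    (CFC.sqrt (CFC.sqrt σ * ρ * CFC.sqrt σ))
  rw [sqrt_mul_sqrt hσ.posSemidef, sqrt_mul_sqrt (sqrt_conj_posDef hρ hσ).posSemidef] at h
  rw [transport, h]
  simp only [← mul_assoc, nonsing_inv_mul _ hu, one_mul]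
  rw [mul_assoc, mul_nonsing_inv _ hu, mul_one]

lemma transport_mul_trace (hσ : σ.PosDef) :
    (transport ρ σ * σ).trace = (CFC.sqrt (CFC.sqrt σ * ρ * CFC.sqrt σ)).trace := by
  have hu := isUnit_det_sqrt hσ
  have e : (CFC.sqrt σ)⁻¹ * σ = CFC.sqrt σ := by
    calc (CFC.sqrt σ)⁻¹ * σ = (CFC.sqrt σ)⁻¹ * (CFC.sqrt σ * CFC.sqrt σ) := by
          rw [sqrt_mul_sqrt hσ.posSemidef]
      _ = CFC.sqrt σ := by rw [← mul_assoc, nonsing_inv_mul _ hu, one_mul]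
  rw [transport, mul_assoc, e, trace_mul_cycle, mul_nonsing_inv _ hu, one_mul]

lemma fidelity_eq_transport (hσ : σ.PosDef) :
    fidelity ρ σ = (transport ρ σ * σ).trace.re := by
  rw [transport_mul_trace hσ, fidelity]

lemma transport_inv_mul (hρ : ρ.PosDef) (hσ : σ.PosDef) :
    (transport ρ σ)⁻¹ * ρ = σ * transport ρ σ := by
  have hu : IsUnit (transport ρ σ).det :=
    (Matrix.isUnit_iff_isUnit_det _).1 (transport_posDef hρ hσ).isUnit
  calc (transport ρ σ)⁻¹ * ρ
      = (transport ρ σ)⁻¹ * (transport ρ σ * σ * transport ρ σ) := by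
        rw [transport_mul_mul_transport hρ hσ]
    _ = σ * transport ρ σ := by
        simp only [← mul_assoc, nonsing_inv_mul _ hu, one_mul]

/-- One half of Uhlmann's theorem: for `X = transport ρ σ` both terms of the bound equal the
fidelity. -/
lemma trace_le_fidelity (hρ : ρ.PosDef) (hσ : σ.PosDef) {A B : Matrix (Fin d) (Fin d) ℂ}
    (hA : A * Aᴴ = ρ) (hB : B * Bᴴ = σ) : (Aᴴ * B).trace.re ≤ fidelity ρ σ := by
  have h := two_mul_trace_le (transport_posDef hρ hσ) A B
  rw [hA, hB, transport_inv_mul hρ hσ, trace_mul_comm σ, ← fidelity_eq_transport hσ] at h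
  linarith

end transport

/-! ### The mean transport, ascent of the fidelity and optimality. -/

/-- The average of the transports from `σ` to the `ρ i`. -/
noncomputable def meanTransport (p : Fin n → ℝ) (ρ : Fin n → Matrix (Fin d) (Fin d) ℂ)
    (σ : Matrix (Fin d) (Fin d) ℂ) : Matrix (Fin d) (Fin d) ℂ :=
  ∑ i, p i • transport (ρ i) σ

lemma exists_pos_of_mem_stdSimplex {p : Fin n → ℝ} (hp : p ∈ stdSimplex ℝ (Fin n)) :
    ∃ i, 0 < p i := by
  by_contra! h
  have := Finset.sum_nonpos fun i (_ : i ∈ Finset.univ) => h i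
  rw [hp.2] at this
  linarith

section

variable {p : Fin n → ℝ} {ρ : Fin n → Matrix (Fin d) (Fin d) ℂ} {σ τ : Matrix (Fin d) (Fin d) ℂ}

lemma meanTransport_posDef (hp : p ∈ stdSimplex ℝ (Fin n)) (hρ : ∀ i, (ρ i).PosDef)
    (hσ : σ.PosDef) : (meanTransport p ρ σ).PosDef := by
  obtain ⟨i, hi⟩ := exists_pos_of_mem_stdSimplex hp
  rw [meanTransport, ← Finset.add_sum_erase _ _ (Finset.mem_univ i)]
  exact ((transport_posDef (hρ i) hσ).smul hi).add_posSemidef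
    (posSemidef_sum _ fun j _ => (transport_posDef (hρ j) hσ).posSemidef.smul (hp.1 j))

lemma meanTransport_eq : meanTransport p ρ σ = (CFC.sqrt σ)⁻¹ *
    (∑ i, p i • CFC.sqrt (CFC.sqrt σ * ρ i * CFC.sqrt σ)) * (CFC.sqrt σ)⁻¹ := by
  simp only [meanTransport, transport, Finset.mul_sum, Finset.sum_mul, mul_smul_comm,
    smul_mul_assoc]

lemma kMap_eq (hσ : σ.PosDef) :
    kMap p ρ σ = meanTransport p ρ σ * σ * meanTransport p ρ σ := by
  have h := conj_inv_mul_mul_conj_inv (isUnit_det_sqrt hσ)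
    (∑ i, p i • CFC.sqrt (CFC.sqrt σ * ρ i * CFC.sqrt σ))
    (∑ i, p i • CFC.sqrt (CFC.sqrt σ * ρ i * CFC.sqrt σ))
  rw [sqrt_mul_sqrt hσ.posSemidef, ← meanTransport_eq] at h
  rw [h, kMap, sq]

lemma kMap_posDef (hp : p ∈ stdSimplex ℝ (Fin n)) (hρ : ∀ i, (ρ i).PosDef)
    (hσ : σ.PosDef) : (kMap p ρ σ).PosDef := by
  have hT := meanTransport_posDef hp hρ hσ
  have := (hT.isUnit.posDef_star_right_conjugate_iff (x := σ)).2 hσ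
  rwa [star_eq_conjTranspose, hT.1.eq, ← kMap_eq hσ] at this

lemma trace_eq_ofReal {A : Matrix (Fin d) (Fin d) ℂ} (hA : A.PosSemidef) :
    A.trace = (A.trace.re : ℂ) :=
  Complex.ext rfl (by simpa using (Complex.le_def.1 hA.trace_nonneg).2.symm)

lemma trace_re_pos [Nonempty (Fin d)] {A : Matrix (Fin d) (Fin d) ℂ} (hA : A.PosDef) :
    0 < A.trace.re :=
  (Complex.lt_def.1 hA.trace_pos).1

lemma normalize_eq {A : Matrix (Fin d) (Fin d) ℂ} (hA : A.PosSemidef) :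
    normalize A = (A.trace.re)⁻¹ • A := by
  rw [normalize, trace_eq_ofReal hA, ← Complex.ofReal_inv, Complex.ofReal_re, Complex.coe_smul]

lemma IsDensity.nonempty (h : IsDensity σ) : Nonempty (Fin d) := by
  rcases isEmpty_or_nonempty (Fin d) with hd | hd
  · have := h.2
    simp [trace] at this
  · exact hd

lemma normalize_isFullRankState [Nonempty (Fin d)] {A : Matrix (Fin d) (Fin d) ℂ}
    (hA : A.PosDef) : IsFullRankState (normalize A) := by
  have h : (normalize A).PosDef := by
    rw [normalize_eq hA.posSemidef]
    exact hA.smul (inv_pos.2 (trace_re_pos hA))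
  refine ⟨h, h.posSemidef, ?_⟩
  rw [normalize, trace_smul, smul_eq_mul, inv_mul_cancel₀ hA.trace_pos.ne']

lemma omegaMap_isFullRankState (hp : p ∈ stdSimplex ℝ (Fin n)) [Nonempty (Fin d)]
    (hρ : ∀ i, (ρ i).PosDef) (hσ : σ.PosDef) : IsFullRankState (omegaMap p ρ σ) :=
  normalize_isFullRankState (kMap_posDef hp hρ hσ)

lemma avgFidelity_eq (hσ : σ.PosDef) :
    avgFidelity p ρ σ = (meanTransport p ρ σ * σ).trace.re := by
  simp only [avgFidelity, fidelity_eq_transport hσ, meanTransport, Finset.sum_mul, trace_sum,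
    Complex.re_sum, smul_mul_assoc, trace_smul, Complex.real_smul, Complex.re_ofReal_mul]

lemma avgFidelity_le_one (hp : p ∈ stdSimplex ℝ (Fin n)) (hρ : ∀ i, IsDensity (ρ i))
    (hσ : IsDensity σ) : avgFidelity p ρ σ ≤ 1 := by
  have h : ∀ i, fidelity (ρ i) σ ≤ 1 := fun i => by
    have := (two_mul_fidelity_le_and_eq PosDef.one (hρ i).1 hσ.1).1
    simp [(hρ i).2, hσ.2] at this
    linarith
  calc avgFidelity p ρ σ ≤ ∑ i, p i * 1 :=
        Finset.sum_le_sum fun i _ => mul_le_mul_of_nonneg_left (h i) (hp.1 i)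
    _ = 1 := by simp [hp.2]

/-- `transport (ρ i) σ * s` and `(√c)⁻¹ • (T * s)` purify `ρ i` and `Ω(σ)`; their overlaps average
to `c / √c = √c`. -/
lemma sqrt_trace_kMap_le (hp : p ∈ stdSimplex ℝ (Fin n)) [Nonempty (Fin d)]
    (hρ : ∀ i, (ρ i).PosDef) (hσ : σ.PosDef) :
    √(kMap p ρ σ).trace.re ≤ avgFidelity p ρ (omegaMap p ρ σ) := by
  have hK := kMap_posDef hp hρ hσ
  have hΩ := (omegaMap_isFullRankState hp hρ hσ).1
  have hc := trace_re_pos hK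
  have hΩeq : omegaMap p ρ σ = ((kMap p ρ σ).trace.re)⁻¹ • kMap p ρ σ :=
    normalize_eq hK.posSemidef
  set c := (kMap p ρ σ).trace.re with hcdef
  have hs := (sqrt_posDef hσ).1.eq
  have hss := sqrt_mul_sqrt hσ.posSemidef
  have hT := (meanTransport_posDef hp hρ hσ).1.eq
  have hk := kMap_eq (p := p) (ρ := ρ) hσ
  set s := CFC.sqrt σ
  set T := meanTransport p ρ σ with hTdef
  have hB : ((√c)⁻¹ • (T * s)) * ((√c)⁻¹ • (T * s))ᴴ = omegaMap p ρ σ := by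
    rw [hΩeq, hk, conjTranspose_smul, conjTranspose_mul, hs, hT, smul_mul_smul_comm, ← hss]
    congr 1
    · simp [← mul_inv, Real.mul_self_sqrt hc.le]
    · simp only [mul_assoc]
  have key : ∀ i, ((√c)⁻¹ * (s * transport (ρ i) σ * T * s).trace.re) ≤
      fidelity (ρ i) (omegaMap p ρ σ) := fun i => by
    have hX := (transport_posDef (hρ i) hσ).1.eq
    have h := trace_le_fidelity (hρ i) hΩ (A := transport (ρ i) σ * s)
      (B := (√c)⁻¹ • (T * s)) (by
        rw [conjTranspose_mul, hs, hX]
        refine Eq.trans ?_ (transport_mul_mul_transport (hρ i) hσ)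
        rw [mul_assoc, ← mul_assoc s, hss, mul_assoc]) hB
    rw [conjTranspose_mul, hs, hX, mul_smul_comm, trace_smul, Complex.real_smul,
      Complex.re_ofReal_mul] at h
    simpa only [mul_assoc] using h
  have hsum : ∑ i, p i * ((√c)⁻¹ * (s * transport (ρ i) σ * T * s).trace.re) = √c := by
    have h1 : ∑ i, p i * (s * transport (ρ i) σ * T * s).trace.re = c := by
      have h2 : (s * T * T * s).trace = (kMap p ρ σ).trace := by
        rw [hk, mul_assoc (s * T), trace_mul_comm, mul_assoc, ← mul_assoc s, hss, mul_assoc]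
      rw [hcdef, ← h2]
      have h3 : s * T * T * s = ∑ i, p i • (s * transport (ρ i) σ * T * s) := by
        have h4 : s * T = ∑ i, p i • (s * transport (ρ i) σ) := by
          simp only [hTdef, meanTransport, Finset.mul_sum, mul_smul_comm]
        simp only [h4, Finset.sum_mul, smul_mul_assoc]
      rw [h3]
      simp only [trace_sum, Complex.re_sum, trace_smul, Complex.real_smul,
        Complex.re_ofReal_mul]
    calc _ = (√c)⁻¹ * ∑ i, p i * (s * transport (ρ i) σ * T * s).trace.re := by
          rw [Finset.mul_sum]; exact Finset.sum_congr rfl fun i _ => by ring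
      _ = √c := by
          rw [h1]
          have := Real.sqrt_pos.2 hc
          field_simp
          rw [Real.sq_sqrt hc.le]
  rw [← hsum]
  exact Finset.sum_le_sum fun i _ => mul_le_mul_of_nonneg_left (key i) (hp.1 i)

/-- At `l = f(σ)` this is the variance of the mean transport in the state `σ`. -/
lemma trace_variance (hp : p ∈ stdSimplex ℝ (Fin n)) (hρ : ∀ i, (ρ i).PosDef)
    (hσ : IsFullRankState σ) (l : ℝ) :
    ((meanTransport p ρ σ - l • 1)ᴴ * σ * (meanTransport p ρ σ - l • 1)).trace.re =
      (kMap p ρ σ).trace.re - 2 * l * avgFidelity p ρ σ + l ^ 2 := by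
  have hT := (meanTransport_posDef hp hρ hσ.1).1.eq
  rw [kMap_eq hσ.1, avgFidelity_eq hσ.1]
  set T := meanTransport p ρ σ
  have : (T - l • 1)ᴴ * σ * (T - l • 1) = T * σ * T - l • (T * σ) - l • (σ * T) + (l * l) • σ := by
    rw [conjTranspose_sub, hT, conjTranspose_smul, conjTranspose_one]
    simp only [sub_mul, mul_sub, smul_mul_assoc, mul_smul_comm, one_mul, mul_one, smul_sub,
      smul_smul, star_trivial]
    abel
  rw [this, trace_add, trace_sub, trace_sub]
  simp only [trace_smul, trace_mul_comm σ, hσ.2.2]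
  simp
  ring

lemma avgFidelity_sq_le (hp : p ∈ stdSimplex ℝ (Fin n)) (hρ : ∀ i, (ρ i).PosDef)
    (hσ : IsFullRankState σ) : avgFidelity p ρ σ ^ 2 ≤ (kMap p ρ σ).trace.re := by
  have h := trace_variance hp hρ hσ (avgFidelity p ρ σ)
  have := trace_conj_nonneg hσ.1 (meanTransport p ρ σ - avgFidelity p ρ σ • 1)
  nlinarith

lemma meanTransport_eq_of_avgFidelity_sq (hp : p ∈ stdSimplex ℝ (Fin n))
    (hρ : ∀ i, (ρ i).PosDef) (hσ : IsFullRankState σ)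
    (h : (kMap p ρ σ).trace.re ≤ avgFidelity p ρ σ ^ 2) :
    meanTransport p ρ σ = avgFidelity p ρ σ • 1 := by
  have h1 := trace_variance hp hρ hσ (avgFidelity p ρ σ)
  have := trace_conj_nonneg hσ.1 (meanTransport p ρ σ - avgFidelity p ρ σ • 1)
  exact sub_eq_zero.1 (eq_zero_of_trace_conj_eq_zero hσ.1 (by nlinarith))

lemma avgFidelity_le_omegaMap (hp : p ∈ stdSimplex ℝ (Fin n)) [Nonempty (Fin d)]
    (hρ : ∀ i, (ρ i).PosDef) (hσ : IsFullRankState σ) :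
    avgFidelity p ρ σ ≤ avgFidelity p ρ (omegaMap p ρ σ) :=
  (Real.le_sqrt_of_sq_le (avgFidelity_sq_le hp hρ hσ)).trans (sqrt_trace_kMap_le hp hρ hσ.1)

lemma avgFidelity_nonneg (hp : p ∈ stdSimplex ℝ (Fin n)) : 0 ≤ avgFidelity p ρ σ :=
  Finset.sum_nonneg fun i _ => mul_nonneg (hp.1 i)
    (Complex.le_def.1 (sqrt_posSemidef _).trace_nonneg).1

lemma trace_kMap_le_one (hp : p ∈ stdSimplex ℝ (Fin n)) (hρ : ∀ i, IsFullRankState (ρ i))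
    [Nonempty (Fin d)] (hσ : σ.PosDef) : (kMap p ρ σ).trace.re ≤ 1 := by
  have h1 := sqrt_trace_kMap_le hp (fun i => (hρ i).1) hσ
  have h2 := avgFidelity_le_one hp (fun i => (hρ i).2)
    (omegaMap_isFullRankState hp (fun i => (hρ i).1) hσ).2
  simpa using Real.sqrt_le_iff.1 (h1.trans h2)

lemma meanTransport_eq_of_avgFidelity_omegaMap_le (hp : p ∈ stdSimplex ℝ (Fin n))
    [Nonempty (Fin d)] (hρ : ∀ i, (ρ i).PosDef) (hσ : IsFullRankState σ)
    (h : avgFidelity p ρ (omegaMap p ρ σ) ≤ avgFidelity p ρ σ) :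
    meanTransport p ρ σ = avgFidelity p ρ σ • 1 := by
  refine meanTransport_eq_of_avgFidelity_sq hp hρ hσ ?_
  exact (Real.sqrt_le_left (avgFidelity_nonneg hp)).1 ((sqrt_trace_kMap_le hp hρ hσ.1).trans h)

/-- Comparison of an arbitrary state with a state whose mean transport is scalar. -/
lemma avgFidelity_le_and_eq_of_meanTransport_eq (hp : p ∈ stdSimplex ℝ (Fin n))
    (hρ : ∀ i, (ρ i).PosDef) (hσ : IsFullRankState σ)
    (h : meanTransport p ρ σ = avgFidelity p ρ σ • 1) (hτ : IsDensity τ) :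
    avgFidelity p ρ τ ≤ avgFidelity p ρ σ ∧
      (avgFidelity p ρ σ ≤ avgFidelity p ρ τ → τ = σ) := by
  have hX := fun i => transport_posDef (hρ i) hσ.1
  have h1 := fun i => two_mul_fidelity_le_and_eq (hX i) (hρ i).posSemidef hτ.1
  have h2 : ∀ i, ((transport (ρ i) σ)⁻¹ * ρ i).trace.re = fidelity (ρ i) σ := fun i => by
    rw [transport_inv_mul (hρ i) hσ.1, trace_mul_comm, fidelity_eq_transport hσ.1]
  simp only [h2] at h1
  have h3 : ∑ i, p i * (transport (ρ i) σ * τ).trace.re = avgFidelity p ρ σ := by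
    have e : (meanTransport p ρ σ * τ).trace.re = avgFidelity p ρ σ := by
      rw [h]
      simp [trace_smul, hτ.2]
    rw [← e]
    simp only [meanTransport, Finset.sum_mul, trace_sum, Complex.re_sum, smul_mul_assoc,
      trace_smul, Complex.real_smul, Complex.re_ofReal_mul]
  have hle : ∀ i ∈ Finset.univ, p i * (2 * fidelity (ρ i) τ) ≤
      p i * (fidelity (ρ i) σ + (transport (ρ i) σ * τ).trace.re) :=
    fun i _ => mul_le_mul_of_nonneg_left (h1 i).1 (hp.1 i)
  have hl : ∑ i, p i * (2 * fidelity (ρ i) τ) = 2 * avgFidelity p ρ τ := by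
    rw [avgFidelity, Finset.mul_sum]; exact Finset.sum_congr rfl fun i _ => by ring
  have hr : ∑ i, p i * (fidelity (ρ i) σ + (transport (ρ i) σ * τ).trace.re) =
      2 * avgFidelity p ρ σ := by
    simp only [mul_add, Finset.sum_add_distrib, h3]
    rw [avgFidelity]; ring
  have hs := Finset.sum_le_sum hle
  rw [hl, hr] at hs
  refine ⟨by linarith, fun hge => ?_⟩
  -- Equality of the sums forces it termwise; a single index of positive weight already determines
  -- `τ`.
  have heq := (Finset.sum_eq_sum_iff_of_le hle).1 (by rw [hl, hr]; linarith)
  obtain ⟨i, hi⟩ := exists_pos_of_mem_stdSimplex hp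
  have h4 := (h1 i).2 (mul_left_cancel₀ hi.ne' (heq i (Finset.mem_univ i)))
  have h5 := h4.trans (transport_mul_mul_transport (hρ i) hσ.1).symm
  exact (hX i).isUnit.mul_left_cancel ((hX i).isUnit.mul_right_cancel h5)

end

/-! ### A uniform lower bound on the determinant. -/

lemma exists_smul_one_le [Nonempty (Fin d)] {A : Matrix (Fin d) (Fin d) ℂ} (hA : A.PosDef) :
    ∃ ε : ℝ, 0 < ε ∧ ε • (1 : Matrix (Fin d) (Fin d) ℂ) ≤ A := by
  have hA' := Matrix.isStrictlyPositive_iff_posDef.2 hA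
  obtain ⟨ε, hε, h⟩ := (CFC.exists_pos_algebraMap_le_iff (a := A) hA.1).2 fun x hx =>
    hA'.spectrum_pos hx
  exact ⟨ε, hε, by rwa [Algebra.algebraMap_eq_smul_one] at h⟩

/-- Operator monotonicity of the square root, applied to `ε • σ ≤ s * ρ * s`. -/
lemma smul_inv_sqrt_le_transport {ρ σ : Matrix (Fin d) (Fin d) ℂ} (hσ : σ.PosDef) {ε : ℝ}
    (hε : 0 < ε) (h : ε • (1 : Matrix (Fin d) (Fin d) ℂ) ≤ ρ) :
    √ε • (CFC.sqrt σ)⁻¹ ≤ transport ρ σ := by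
  have hs := sqrt_posDef hσ
  have hu := isUnit_det_sqrt hσ
  have hss := sqrt_mul_sqrt hσ.posSemidef
  rw [transport]
  set s := CFC.sqrt σ
  have h1 : √ε • s ≤ CFC.sqrt (s * ρ * s) := by
    have e : CFC.sqrt (ε • σ) = √ε • s := by
      refine sqrt_eq_of_mul_self (hs.posSemidef.smul (Real.sqrt_nonneg ε)) ?_
      rw [smul_mul_smul_comm, Real.mul_self_sqrt hε.le, hss]
    rw [← e]
    refine sqrt_mono (le_iff.2 ?_)
    have h2 := (le_iff.1 h).conjTranspose_mul_mul_same s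
    rwa [hs.1.eq, mul_sub, sub_mul, mul_smul_comm, smul_mul_assoc, mul_one, hss] at h2
  have h3 := (le_iff.1 h1).conjTranspose_mul_mul_same s⁻¹
  rw [hs.inv.1.eq, mul_sub, sub_mul, mul_smul_comm, smul_mul_assoc, nonsing_inv_mul _ hu,
    one_mul] at h3
  exact le_iff.2 h3

lemma det_eq_ofReal {A : Matrix (Fin d) (Fin d) ℂ} (hA : A.PosSemidef) :
    A.det = (A.det.re : ℂ) :=
  Complex.ext rfl (by simpa using (Complex.le_def.1 hA.det_nonneg).2.symm)

lemma det_re_pos {A : Matrix (Fin d) (Fin d) ℂ} (hA : A.PosDef) : 0 < A.det.re :=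
  (Complex.lt_def.1 hA.det_pos).1

section

variable {p : Fin n → ℝ} {ρ : Fin n → Matrix (Fin d) (Fin d) ℂ}

lemma exists_smul_inv_sqrt_le_meanTransport (hp : p ∈ stdSimplex ℝ (Fin n))
    [Nonempty (Fin d)] (hρ : ∀ i, (ρ i).PosDef) :
    ∃ η : ℝ, 0 < η ∧ ∀ σ : Matrix (Fin d) (Fin d) ℂ, σ.PosDef →
      η • (CFC.sqrt σ)⁻¹ ≤ meanTransport p ρ σ := by
  choose ε hε hle using fun i => exists_smul_one_le (hρ i)
  refine ⟨∑ i, p i * √(ε i), ?_, fun σ hσ => ?_⟩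
  · obtain ⟨i, hi⟩ := exists_pos_of_mem_stdSimplex hp
    exact Finset.sum_pos' (fun j _ => mul_nonneg (hp.1 j) (Real.sqrt_nonneg _))
      ⟨i, Finset.mem_univ i, mul_pos hi (Real.sqrt_pos.2 (hε i))⟩
  · rw [Finset.sum_smul, meanTransport, le_iff, ← Finset.sum_sub_distrib]
    refine posSemidef_sum _ fun i _ => ?_
    rw [mul_smul, ← smul_sub]
    exact (le_iff.1 (smul_inv_sqrt_le_transport hσ (hε i) (hle i))).smul (hp.1 i)

/-- In `det K(σ) = (det T * det √σ)²` the bound `T ≥ η • (√σ)⁻¹` cancels the dependence on `σ`.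
Since `Tr K(σ) ≤ 1`, normalizing cannot lower the determinant. -/
lemma exists_le_det_omegaMap (hp : p ∈ stdSimplex ℝ (Fin n)) [Nonempty (Fin d)]
    (hρ : ∀ i, IsFullRankState (ρ i)) :
    ∃ δ : ℝ, 0 < δ ∧ ∀ σ : Matrix (Fin d) (Fin d) ℂ, σ.PosDef →
      δ ≤ (omegaMap p ρ σ).det.re := by
  obtain ⟨η, hη, hle⟩ := exists_smul_inv_sqrt_le_meanTransport hp fun i => (hρ i).1
  refine ⟨(η ^ d) ^ 2, by positivity, fun σ hσ => ?_⟩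
  have hT := meanTransport_posDef hp (fun i => (hρ i).1) hσ
  have hs := sqrt_posDef hσ
  have hK := kMap_posDef hp (fun i => (hρ i).1) hσ
  have h1 := det_le_det (hs.inv.smul hη) (hle σ hσ)
  have hu := det_re_pos hs
  have ht := det_re_pos hT
  have hdet : (kMap p ρ σ).det.re =
      ((meanTransport p ρ σ).det.re * (CFC.sqrt σ).det.re) ^ 2 := by
    rw [kMap_eq hσ]
    have : σ.det = (CFC.sqrt σ).det * (CFC.sqrt σ).det := by
      rw [← det_mul, sqrt_mul_sqrt hσ.posSemidef]
    rw [det_mul, det_mul, this, det_eq_ofReal hT.posSemidef, det_eq_ofReal hs.posSemidef]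
    norm_cast
    ring
  have hinv : (η • (CFC.sqrt σ)⁻¹).det.re = η ^ d * ((CFC.sqrt σ).det.re)⁻¹ := by
    rw [det_smul_of_tower, det_nonsing_inv, Ring.inverse_eq_inv', det_eq_ofReal hs.posSemidef,
      Fintype.card_fin, Complex.real_smul]
    norm_cast
  rw [hinv, ← div_eq_mul_inv, div_le_iff₀ hu] at h1
  have h2 : (η ^ d) ^ 2 ≤ (kMap p ρ σ).det.re := by
    rw [hdet]
    exact pow_le_pow_left₀ (by positivity) h1 2
  have hc := trace_re_pos hK
  have hc1 := trace_kMap_le_one hp hρ hσ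
  rw [omegaMap, normalize_eq hK.posSemidef, det_smul_of_tower, Complex.smul_re, smul_eq_mul]
  refine h2.trans (le_mul_of_one_le_left (det_re_pos hK).le (one_le_pow₀ ?_))
  exact (one_le_inv₀ hc).2 hc1

/-! ### Continuity and cluster points of the iteration. -/

lemma continuousOn_sqrt_conj (A : Matrix (Fin d) (Fin d) ℂ) (hA : A.PosSemidef) :
    ContinuousOn (fun σ => CFC.sqrt (CFC.sqrt σ * A * CFC.sqrt σ))
      {σ : Matrix (Fin d) (Fin d) ℂ | σ.PosSemidef} := by
  refine continuousOn_matrix_sqrt.comp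
    ((continuousOn_matrix_sqrt.mul continuousOn_const).mul continuousOn_matrix_sqrt) ?_
  intro σ _
  have := hA.conjTranspose_mul_mul_same (CFC.sqrt σ)
  rwa [(sqrt_posSemidef σ).1.eq] at this

lemma continuousOn_avgFidelity (hρ : ∀ i, (ρ i).PosSemidef) :
    ContinuousOn (avgFidelity p ρ) {σ | σ.PosSemidef} := by
  refine continuousOn_finsetSum _ fun i _ => continuousOn_const.mul ?_
  exact (Complex.continuous_re.comp continuous_id.matrix_trace).comp_continuousOn
    (continuousOn_sqrt_conj (ρ i) (hρ i))

lemma continuousOn_omegaMap (hp : p ∈ stdSimplex ℝ (Fin n)) [Nonempty (Fin d)]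
    (hρ : ∀ i, (ρ i).PosDef) :
    ContinuousOn (omegaMap p ρ) {σ | σ.PosDef} := by
  have hinv : ContinuousOn (fun σ : Matrix (Fin d) (Fin d) ℂ => (CFC.sqrt σ)⁻¹)
      {σ | σ.PosDef} := by
    intro σ hσ
    refine ContinuousAt.comp_continuousWithinAt (g := Inv.inv) ?_
      ((continuousOn_matrix_sqrt σ hσ.posSemidef).mono fun τ hτ => PosDef.posSemidef hτ)
    refine continuousAt_matrix_inv _ ?_
    rw [Ring.inverse_eq_inv']
    exact continuousAt_inv₀ (isUnit_det_sqrt hσ).ne_zero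
  have hS : ContinuousOn (fun σ : Matrix (Fin d) (Fin d) ℂ =>
      ∑ i, p i • CFC.sqrt (CFC.sqrt σ * ρ i * CFC.sqrt σ)) {σ | σ.PosDef} :=
    continuousOn_finsetSum _ fun i _ =>
      ((continuousOn_sqrt_conj (ρ i) (hρ i).posSemidef).mono fun τ (hτ : τ.PosDef) =>
        hτ.posSemidef).fun_const_smul (p i)
  have hK : ContinuousOn (kMap p ρ) {σ | σ.PosDef} := (hinv.mul (hS.pow 2)).mul hinv
  have htr : ContinuousOn (fun σ => (kMap p ρ σ).trace) {σ | σ.PosDef} :=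
    continuous_id.matrix_trace.comp_continuousOn hK
  exact (htr.inv₀ fun σ hσ => (kMap_posDef hp hρ hσ).trace_pos.ne').smul hK

open Filter Topology

variable {σ x : Matrix (Fin d) (Fin d) ℂ}

lemma iterate_omegaMap_isFullRankState (hp : p ∈ stdSimplex ℝ (Fin n)) [Nonempty (Fin d)]
    (hρ : ∀ i, IsFullRankState (ρ i)) (hσ : IsFullRankState σ) (k : ℕ) :
    IsFullRankState ((omegaMap p ρ)^[k] σ) := by
  induction k with
  | zero => exact hσ
  | succ k ih =>
    rw [Function.iterate_succ_apply']
    exact omegaMap_isFullRankState hp (fun i => (hρ i).1) ih.1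

lemma meanTransport_eq_of_mapClusterPt (hp : p ∈ stdSimplex ℝ (Fin n)) [Nonempty (Fin d)]
    (hρ : ∀ i, IsFullRankState (ρ i)) (hσ : IsFullRankState σ) (hx : IsDensity x)
    (hcl : MapClusterPt x atTop fun k => (omegaMap p ρ)^[k] σ) :
    IsFullRankState x ∧ meanTransport p ρ x = avgFidelity p ρ x • 1 := by
  have hpd := fun i => (hρ i).1
  have hu := iterate_omegaMap_isFullRankState hp hρ hσ
  have hsucc : ∀ k, (omegaMap p ρ)^[k + 1] σ = omegaMap p ρ ((omegaMap p ρ)^[k] σ) :=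
    fun k => Function.iterate_succ_apply' _ _ _
  have : FirstCountableTopology (Matrix (Fin d) (Fin d) ℂ) :=
    inferInstanceAs (FirstCountableTopology (Fin d → Fin d → ℂ))
  obtain ⟨ψ, hψ, hlim⟩ := hcl.tendsto_subseq
  set u := fun k => (omegaMap p ρ)^[k] σ with hudef
  obtain ⟨δ, hδ, hdet⟩ := exists_le_det_omegaMap hp hρ
  have hxdet : δ ≤ x.det.re := by
    refine ge_of_tendsto (((Complex.continuous_re.comp continuous_id.matrix_det).tendsto x).comp
      hlim) ?_
    -- The determinant bound holds for values of `Ω`, so the initial state is skipped.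
    filter_upwards [eventually_ge_atTop 1] with k hk
    obtain ⟨m, hm⟩ := Nat.exists_eq_add_of_le' (hk.trans (hψ.id_le k))
    simp only [Function.comp, hm, hudef, hsucc, id]
    exact hdet _ (hu m).1
  have hxpd : x.PosDef := hx.1.posDef_iff_det_ne_zero.2 fun h => by
    rw [h] at hxdet
    exact hδ.not_ge hxdet
  refine ⟨⟨hxpd, hx⟩, ?_⟩
  have hmono : Monotone fun k => avgFidelity p ρ (u k) := monotone_nat_of_le_succ fun k => by
    simp only [hudef, hsucc]
    exact avgFidelity_le_omegaMap hp hpd (hu k)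
  have hbdd : BddAbove (Set.range fun k => avgFidelity p ρ (u k)) :=
    ⟨1, by rintro _ ⟨k, rfl⟩; exact avgFidelity_le_one hp (fun i => (hρ i).2) (hu k).2⟩
  have hL := tendsto_atTop_ciSup hmono hbdd
  have hcont := continuousOn_avgFidelity (p := p) fun i => (hpd i).posSemidef
  have h1 : Tendsto (fun k => avgFidelity p ρ (u (ψ k))) atTop (𝓝 (avgFidelity p ρ x)) :=
    (hcont x hx.1).tendsto.comp (tendsto_nhdsWithin_iff.2
      ⟨hlim, Eventually.of_forall fun k => (hu (ψ k)).2.1⟩)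
  have hΩ : Tendsto (fun k => omegaMap p ρ (u (ψ k))) atTop (𝓝 (omegaMap p ρ x)) :=
    (continuousOn_omegaMap hp hpd x hxpd).tendsto.comp (tendsto_nhdsWithin_iff.2
      ⟨hlim, Eventually.of_forall fun k => (hu (ψ k)).1⟩)
  have h2 : Tendsto (fun k => avgFidelity p ρ (u (ψ k + 1))) atTop
      (𝓝 (avgFidelity p ρ (omegaMap p ρ x))) := by
    simp only [hudef, hsucc]
    exact (hcont _ (omegaMap_isFullRankState hp hpd hxpd).2.1).tendsto.comp
      (tendsto_nhdsWithin_iff.2 ⟨hΩ, Eventually.of_forall fun k =>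
        (omegaMap_isFullRankState hp hpd (hu (ψ k)).1).2.1⟩)
  -- The subsequence and its shift by one share the limit of the monotone sequence, so `f(Ω(x)) =
  -- f(x)`.
  have h3 := tendsto_nhds_unique h1 (hL.comp hψ.tendsto_atTop)
  have h4 := tendsto_nhds_unique h2
    (hL.comp ((tendsto_add_atTop_nat 1).comp hψ.tendsto_atTop))
  exact meanTransport_eq_of_avgFidelity_omegaMap_le hp hpd ⟨hxpd, hx⟩ (h4.trans h3.symm).le

end

end AvgFidelity

theorem mainTheorem3 (d n : ℕ) (p : Fin n → ℝ) (hp : p ∈ stdSimplex ℝ (Fin n))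
    (ρ : Fin n → Matrix (Fin d) (Fin d) ℂ) (hρ : ∀ i, AvgFidelity.IsFullRankState (ρ i)) :
    (∀ σ : Matrix (Fin d) (Fin d) ℂ, σ.PosDef →
      AvgFidelity.IsFullRankState (AvgFidelity.omegaMap p ρ σ)) ∧
    ∃ σopt : Matrix (Fin d) (Fin d) ℂ,
      AvgFidelity.IsOptimalState p ρ σopt ∧
      (∀ τ : Matrix (Fin d) (Fin d) ℂ, AvgFidelity.IsOptimalState p ρ τ → τ = σopt) ∧
      ∀ σ : Matrix (Fin d) (Fin d) ℂ, AvgFidelity.IsFullRankState σ →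
        Filter.Tendsto (fun k : ℕ => (AvgFidelity.omegaMap p ρ)^[k] σ) Filter.atTop
          (nhds σopt) := by
  obtain ⟨i, -⟩ := AvgFidelity.exists_pos_of_mem_stdSimplex hp
  have := (hρ i).2.nonempty
  have hpd := fun i => (hρ i).1
  refine ⟨fun σ => AvgFidelity.omegaMap_isFullRankState hp hpd, ?_⟩
  have hmem : ∀ σ, AvgFidelity.IsFullRankState σ → ∀ᶠ k in Filter.atTop,
      (AvgFidelity.omegaMap p ρ)^[k] σ ∈ {σ | AvgFidelity.IsDensity σ} := fun σ hσ =>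
    Filter.Eventually.of_forall fun k =>
      (AvgFidelity.iterate_omegaMap_isFullRankState hp hρ hσ k).2
  -- Any full-rank starting point would do; `ρ i` is at hand.
  obtain ⟨x, hx, hcl⟩ := AvgFidelity.isCompact_density.exists_mapClusterPt
    (Filter.le_principal_iff.2 (hmem (ρ i) (hρ i)))
  obtain ⟨hxf, hxT⟩ := AvgFidelity.meanTransport_eq_of_mapClusterPt hp hρ (hρ i) hx hcl
  have hopt := fun τ (hτ : AvgFidelity.IsDensity τ) =>
    AvgFidelity.avgFidelity_le_and_eq_of_meanTransport_eq hp hpd hxf hxT hτ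
  refine ⟨x, ⟨hx, fun τ hτ => (hopt τ hτ).1⟩, fun τ hτ => (hopt τ hτ.1).2 (hτ.2 x hx),
    fun σ hσ => ?_⟩
  refine AvgFidelity.isCompact_density.tendsto_nhds_of_unique_mapClusterPt (hmem σ hσ) ?_
  intro y hy hycl
  obtain ⟨hyf, hyT⟩ := AvgFidelity.meanTransport_eq_of_mapClusterPt hp hρ hσ hy hycl
  exact (hopt y hy).2
    (AvgFidelity.avgFidelity_le_and_eq_of_meanTransport_eq hp hpd hyf hyT hx).1
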